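/- Let $k$ be an infinite field, let $S=k[x_0,\dots,x_n]$, and let $W$ be an $(r+1)$-dimensional $k$-vector space of forms of the same degree in $S$, with basis $f_0,\dots,f_r$. Assume that the ideal $I=(f_0,\dots,f_r)$ generated by $W$ has codimension at least $2$ (the unit ideal having codimension $\infty$), and let $\phi=[f_0:\dots:f_r]:\mathbf P^n\dashrightarrow\mathbf P^r=\mathbf P(W)$ be the associated rational map. Let $A=(A_{ij})$ be a matrix of homogeneous forms of $S$ with $r+1$ rows, each of whose columns is a syzygy on $f_0,\dots,f_r$, i.e. $\sum_i f_iA_{ij}=0$ for all $j$. For a $k$-rational point $q=[q_0:\dots:q_r]$ of $\mathbf P^r$ let $A_q\subset S$ be the ideal generated by the entries $\sum_i q_iA_{ij}$ of the generalized row of $A$ corresponding to $q$. Suppose that, for some such $q$, there is a prime ideal $P$ of $S$ containing $A_q$ such that the matrix $A\otimes\kappa(P)$ over the residue field $\kappa(P)$ of $P$ has rank $r$. Then: 1. If the subscheme of $\mathbf P^n$ defined by $A_q$ is a reduced $k$-rational point, then $\phi$ is birational onto its image. 2. If the subscheme of $\mathbf P^n$ defined by $A_q$ is a (nonempty) linear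 subspace of codimension $r$ with its reduced structure, then the restriction of $\phi$ to a general linear subspace $\mathbf P^r\subset\mathbf P^n$ is a birational map $\mathbf P^r\dashrightarrow\mathbf P^r$, that is, a Cremona transformation. -/

import Mathlib

open MvPolynomial
open scoped LinearAlgebra.Projectivization

noncomputable section

namespace RowIdeals

variable {k : Type*} [Field k]

/-- The ideal of `k[x_0,…,x_n]` generated by the linear forms vanishing on the subspace `V` of
`k^{n+1}`, i.e. the homogeneous ideal of the (reduced) linear subvariety `ℙ(V) ⊆ ℙⁿ` consisting of
the lines in `V`. -/
def linearIdeal {n : ℕ} (V : Submodule k (Fin (n + 1) → k)) :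
    Ideal (MvPolynomial (Fin (n + 1)) k) :=
  Ideal.span {l | ∃ a : Fin (n + 1) → k, (∀ v ∈ V, ∑ i, a i * v i = 0) ∧ l = ∑ i, C (a i) * X i}

/-- The saturation `⋃_N (J : 𝔪^N)` of `J` with respect to `𝔪 = (x_0,…,x_n)`. Two homogeneous ideals
define the same closed subscheme of `ℙⁿ` iff their saturations agree. -/
def saturation {n : ℕ} (J : Ideal (MvPolynomial (Fin (n + 1)) k)) :
    Ideal (MvPolynomial (Fin (n + 1)) k) :=
  ⨆ N : ℕ, J.colon ((idealOfVars (Fin (n + 1)) k ^ N : Ideal _) : Set _)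

theorem mem_saturation {n : ℕ} {J : Ideal (MvPolynomial (Fin (n + 1)) k)}
    {a : MvPolynomial (Fin (n + 1)) k} :
    a ∈ saturation J ↔ ∃ N : ℕ, ∀ b ∈ idealOfVars (Fin (n + 1)) k ^ N, a * b ∈ J := by
  unfold saturation
  rw [Submodule.mem_iSup_of_directed]
  · simp [Submodule.mem_colon]
  · refine Monotone.directed_le fun N M h => ?_
    exact Submodule.colon_mono le_rfl (Ideal.pow_le_pow_right h)

/-- The subscheme of `ℙⁿ` defined by `J` is a reduced `k`-rational point. -/
def DefinesReducedRationalPoint {n : ℕ} (J : Ideal (MvPolynomial (Fin (n + 1)) k)) : Prop :=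
  ∃ p : ℙ k (Fin (n + 1) → k), saturation J = linearIdeal p.submodule

/-- The subscheme of `ℙⁿ` defined by `J` is a (nonempty) linear subspace of codimension `c`, with
its reduced structure. -/
def DefinesReducedLinearSpace {n : ℕ} (J : Ideal (MvPolynomial (Fin (n + 1)) k)) (c : ℕ) : Prop :=
  ∃ V : Submodule k (Fin (n + 1) → k), V ≠ ⊥ ∧ Module.finrank k V + c = n + 1 ∧
    saturation J = linearIdeal V

/-- The ideal `A_q`, generated by the entries of the generalized row of `A` corresponding to the
`k`-rational point `q = [q_0 : … : q_r]` of `ℙ^r = ℙ(W)`, where `W` has basis `f_0,…,f_r`. The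
hyperplane `W_q` of `W` is `{∑ a_i f_i | ∑ a_i q_i = 0}`, so `W → W / W_q ≅ k` sends `f_i` to `q_i`
and the entries of the generalized row are the `∑ i, q_i A_{ij}`. -/
def generalizedRowIdeal {n r m : ℕ} (A : Matrix (Fin (r + 1)) (Fin m) (MvPolynomial (Fin (n + 1)) k))
    (q : ℙ k (Fin (r + 1) → k)) : Ideal (MvPolynomial (Fin (n + 1)) k) :=
  Ideal.span (Set.range fun j : Fin m => ∑ i, C (q.rep i) * A i j)

/-- The rational map `ℙⁿ ⇢ ℙ^r`, `x ↦ [f_0(x) : … : f_r(x)]`, given by forms `f_i` of the same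
degree, is birational onto (the closure of) its image `Y`: there is a rational map `Y ⇢ ℙⁿ`, given
by forms `g_0,…,g_n` of the same degree in the homogeneous coordinates `y_0,…,y_r` of `ℙ^r`, such
that both composites are defined (not all their coordinates vanish identically) and equal the
identity of `ℙⁿ` and of `Y`, as rational maps. A form `h` vanishes on `Y` iff
`h(f_0,…,f_r) = aeval f h = 0`; two tuples of coordinates define the same rational map iff their
`2 × 2` minors vanish. -/
def IsBirationalOntoImage {n r : ℕ} (f : Fin (r + 1) → MvPolynomial (Fin (n + 1)) k) : Prop :=
  ∃ (e : ℕ) (g : Fin (n + 1) → MvPolynomial (Fin (r + 1)) k),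
    (∀ i, (g i).IsHomogeneous e) ∧
    (∃ i, aeval f (g i) ≠ 0) ∧
    (∀ i j, aeval f (g i) * X j = aeval f (g j) * X i) ∧
    (∃ i, aeval f (aeval g (f i)) ≠ 0) ∧
    (∀ i j, aeval f (aeval g (f i) * X j - aeval g (f j) * X i) = 0)

/-- The rational map `ℙ^r ⇢ ℙ^r` given by forms `f_0,…,f_r` of the same degree is a Cremona
transformation, i.e. it has an inverse rational map `ℙ^r ⇢ ℙ^r`. -/
def IsCremona {r : ℕ} (f : Fin (r + 1) → MvPolynomial (Fin (r + 1)) k) : Prop :=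
  ∃ (e : ℕ) (g : Fin (r + 1) → MvPolynomial (Fin (r + 1)) k),
    (∀ i, (g i).IsHomogeneous e) ∧
    (∃ i, aeval f (g i) ≠ 0) ∧
    (∀ i j, aeval f (g i) * X j = aeval f (g j) * X i) ∧
    (∃ i, aeval g (f i) ≠ 0) ∧
    (∀ i j, aeval g (f i) * X j = aeval g (f j) * X i)

/-- The restriction of `[f_0 : … : f_r]` to the image of the linear map `ℙ^s → ℙⁿ`, `y ↦ M y`
(a linear embedding when `M` has rank `s + 1`). -/
def restrictTo {n r s : ℕ} (f : Fin (r + 1) → MvPolynomial (Fin (n + 1)) k)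
    (M : Matrix (Fin (n + 1)) (Fin (s + 1)) k) : Fin (r + 1) → MvPolynomial (Fin (s + 1)) k :=
  fun i => aeval (fun a => ∑ b, C (M a b) * X b) (f i)

/-- The property `Q` holds for a general (linearly parametrized) `ℙ^s ⊆ ℙⁿ`: there is a nonzero
polynomial `G` in the entries of an `(n+1) × (s+1)` matrix such that `Q` holds for every linear
embedding `ℙ^s ↪ ℙⁿ` outside the hypersurface `G = 0`. -/
def ForGeneralLinearSubspace (n s : ℕ) (Q : Matrix (Fin (n + 1)) (Fin (s + 1)) k → Prop) : Prop :=
  ∃ G : MvPolynomial (Fin (n + 1) × Fin (s + 1)) k, G ≠ 0 ∧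
    ∀ M : Matrix (Fin (n + 1)) (Fin (s + 1)) k, M.rank = s + 1 →
      eval (fun ab => M ab.1 ab.2) G ≠ 0 → Q M

end RowIdeals

end

noncomputable section

namespace RowIdeals

/-! Rank `r` at `P` yields a determinant δ ∉ `P` of size `r`, built from combinations of the columns
of `A` with row `i₀` deleted, where `q i₀ ≠ 0`. Cramer's rule makes δ f_i a multiple of f_{i₀} and,
modulo the row ideal, δ q_i the same multiple of q_{i₀}. Hence f is proportional to q modulo every
prime J that contains the row ideal but not δ, and codimension at least 2 forces f_{i₀} ∉ J
(`notMem_and_mul_sub_mul_mem`). So q lies in the closure of the image.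

If the row ideal defines the reduced point [c], then in a large degree every monomial is congruent
to a multiple of a power of x_a. The syzygies realizing these congruences, expanded in monomials,
form a square linear system whose coefficients are linear in y. It is the identity at y = q, hence
nonsingular at y = f, and Cramer's rule recovers x_i / x_a from f (`exists_leftInverse`). A rational
left inverse already gives birationality onto the image.

In part 2 a general ℙ^r meets the linear space in one reduced point, and the same argument applies
to the restricted forms. A left inverse makes these `r + 1` forms algebraically independent
(`algebraicIndependent_of_leftInverse`), so the image is all of ℙ^r. -/

/-! ### Rank `r` at a prime and codimension two -/

open Matrix in
/-- A matrix over a field of rank `r` with `r + 1` rows whose left kernel contains `q` has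
column space `q^⊥`. -/
theorem exists_mulVec_eq_of_rank {F : Type*} [Field F] {r m : ℕ}
    (A : Matrix (Fin (r + 1)) (Fin m) F) (q : Fin (r + 1) → F) (hq : q ≠ 0)
    (hqA : q ᵥ* A = 0) (hrank : A.rank = r) (u : Fin (r + 1) → F) (hu : q ⬝ᵥ u = 0) :
    ∃ c, A *ᵥ c = u := by
  let φ : (Fin (r + 1) → F) →ₗ[F] F := dotProductBilin F F q
  have hφ : φ ≠ 0 := by
    intro h
    apply hq
    ext i
    have := LinearMap.congr_fun h (Pi.single i 1)
    simpa [φ] using this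
  have hle : LinearMap.range A.mulVecLin ≤ LinearMap.ker φ := by
    rintro _ ⟨c, rfl⟩
    simp [φ, dotProduct_mulVec, hqA]
  have hker : Module.finrank F (LinearMap.ker φ) = r := by
    have h1 := LinearMap.finrank_range_add_finrank_ker φ
    rw [LinearMap.range_eq_top.mpr (LinearMap.surjective hφ)] at h1
    simp at h1
    omega
  have heq := Submodule.eq_of_le_of_finrank_eq hle (by rw [hker]; exact hrank)
  have : u ∈ LinearMap.range A.mulVecLin := by
    rw [heq]; exact hu
  simpa using this

-- Over the residue field the column space is q^⊥, which contains the vectors q_{i₀} e_t − q_t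
-- e_{i₀}. Off row `i₀` they form a nonzero scalar matrix; clearing denominators and lifting to `S`
-- gives `C`.
open Matrix in
theorem exists_det_notMem_of_rank {S : Type*} [CommRing S] {r m : ℕ}
    (A : Matrix (Fin (r + 1)) (Fin m) S) (P : Ideal S) [P.IsPrime]
    (hrank : (A.map (algebraMap S P.ResidueField)).rank = r)
    (q : Fin (r + 1) → S) (i₀ : Fin (r + 1)) (hq : q i₀ ∉ P) (hqA : ∀ j, (q ᵥ* A) j ∈ P) :
    ∃ C : Matrix (Fin m) (Fin r) S, (A.submatrix i₀.succAbove id * C).det ∉ P := by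
  let F := P.ResidueField
  let π := algebraMap S F
  have hπ : ∀ x, π x = 0 ↔ x ∈ P := fun x => Ideal.algebraMap_residueField_eq_zero
  have hqA' : (π ∘ q) ᵥ* A.map π = 0 := by
    ext j
    rw [← RingHom.map_vecMul]
    exact (hπ _).2 (hqA j)
  have hq0 : π (q i₀) ≠ 0 := fun h => hq ((hπ _).1 h)
  have hcol : ∀ t : Fin r, ∃ c : Fin m → F,
      A.map π *ᵥ c = Pi.single (i₀.succAbove t) (π (q i₀)) - Pi.single i₀ (π (q (i₀.succAbove t))) := by
    intro t
    refine exists_mulVec_eq_of_rank _ (π ∘ q) (fun h => hq0 (congrFun h i₀)) hqA' hrank _ ?_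
    simp [dotProduct_sub, mul_comm]
  choose c hc using hcol
  obtain ⟨⟨s, hs⟩, hb⟩ := IsLocalization.exist_integer_multiples_of_finite
    (nonZeroDivisors (S ⧸ P)) (fun tj : Fin r × Fin m => c tj.1 tj.2)
  have hb' : ∀ t j, ∃ b : S, π b = algebraMap (S ⧸ P) F s * c t j := by
    intro t j
    obtain ⟨b, hb⟩ := hb (t, j)
    obtain ⟨b, rfl⟩ := Ideal.Quotient.mk_surjective b
    refine ⟨b, ?_⟩
    rw [Algebra.smul_def] at hb
    exact hb
  choose C hC using hb'
  refine ⟨Matrix.of fun j t => C t j, fun h => ?_⟩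
  rw [← hπ, RingHom.map_det] at h
  have hs0 : algebraMap (S ⧸ P) F s ≠ 0 :=
    (map_ne_zero_iff _ (IsFractionRing.injective (S ⧸ P) F)).2 (nonZeroDivisors.ne_zero hs)
  have : π.mapMatrix (A.submatrix i₀.succAbove id * Matrix.of fun j t => C t j)
      = (algebraMap (S ⧸ P) F s * π (q i₀)) • (1 : Matrix (Fin r) (Fin r) F) := by
    ext u t
    have h1 := congrFun (hc t) (i₀.succAbove u)
    simp only [Matrix.mulVec, dotProduct, Matrix.map_apply, Pi.sub_apply, Pi.single_apply,
      Fin.succAbove_right_inj, Fin.succAbove_ne, if_false, sub_zero] at h1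
    simp only [RingHom.mapMatrix_apply, Matrix.map_apply, Matrix.mul_apply, map_sum, map_mul,
      Matrix.submatrix_apply, id, Matrix.of_apply, hC, Matrix.smul_apply, Matrix.one_apply,
      smul_eq_mul, mul_assoc]
    rw [Finset.sum_congr rfl (fun j _ => mul_left_comm _ _ _), ← Finset.mul_sum, h1]
    simp
  rw [this] at h
  simp [hs0, hq0] at h

-- Cramer's rule with row `i₀` split off: `C` times the adjugate inverts the remaining rows up to
-- the determinant. It serves both for the forms, where the right side vanishes, and for q, where it
-- lies in the row ideal.
open Matrix in
theorem det_mul_add_eq_vecMul {S : Type*} [CommRing S] {r m : ℕ}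
    (A : Matrix (Fin (r + 1)) (Fin m) S) (i₀ : Fin (r + 1)) (C : Matrix (Fin m) (Fin r) S)
    (f : Fin (r + 1) → S) (t : Fin r) :
    (A.submatrix i₀.succAbove id * C).det * f (i₀.succAbove t) +
      f i₀ * (A i₀ ᵥ* (C * (A.submatrix i₀.succAbove id * C).adjugate)) t =
    ((f ᵥ* A) ᵥ* (C * (A.submatrix i₀.succAbove id * C).adjugate)) t := by
  have h : f ᵥ* A = (f ∘ i₀.succAbove) ᵥ* A.submatrix i₀.succAbove id + f i₀ • A i₀ := by
    ext j
    simp [vecMul, dotProduct, Fin.sum_univ_succAbove _ i₀, add_comm]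
  rw [h, add_vecMul, smul_vecMul, vecMul_vecMul, ← Matrix.mul_assoc, mul_adjugate]
  simp [vecMul_smul]

-- If `f i₀ ∈ J`, a minimal prime of `f i₀` inside `J` has height at most one by Krull, yet contains
-- every `f i` because it omits δ; this contradicts codimension 2. Eliminating the common multiplier
-- from the two Cramer identities gives the proportionality.
open Matrix in
theorem notMem_and_mul_sub_mul_mem {S : Type*} [CommRing S] [IsNoetherianRing S] {r m : ℕ}
    (A : Matrix (Fin (r + 1)) (Fin m) S) (f q : Fin (r + 1) → S)
    (hcodim : 2 ≤ (Ideal.span (Set.range f)).height) (hfA : f ᵥ* A = 0)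
    (J : Ideal S) [J.IsPrime] (hqA : ∀ j, (q ᵥ* A) j ∈ J) (i₀ : Fin (r + 1))
    (C : Matrix (Fin m) (Fin r) S) (hC : (A.submatrix i₀.succAbove id * C).det ∉ J) :
    f i₀ ∉ J ∧ ∀ i, f i * q i₀ - f i₀ * q i ∈ J := by
  set δ := (A.submatrix i₀.succAbove id * C).det
  have hf := fun t => det_mul_add_eq_vecMul A i₀ C f t
  have hq := fun t => det_mul_add_eq_vecMul A i₀ C q t
  set c := A i₀ ᵥ* (C * (A.submatrix i₀.succAbove id * C).adjugate)
  simp only [hfA, zero_vecMul, Pi.zero_apply] at hf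
  constructor
  · intro h
    obtain ⟨Q, hQ, hQJ⟩ := Ideal.exists_minimalPrimes_le
      ((Ideal.span_singleton_le_iff_mem (I := J)).2 h)
    have := hQ.1.1
    have h1 := Ideal.height_le_one_of_isPrincipal_of_mem_minimalPrimes _ Q hQ
    have h0 : f i₀ ∈ Q := hQ.1.2 (Ideal.mem_span_singleton_self _)
    have : Ideal.span (Set.range f) ≤ Q := by
      rw [Ideal.span_le]
      rintro _ ⟨i, rfl⟩
      rcases Fin.eq_self_or_eq_succAbove i₀ i with rfl | ⟨t, rfl⟩
      · exact h0
      · have : δ * f (i₀.succAbove t) ∈ Q := by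
          rw [eq_neg_of_add_eq_zero_left (hf t)]
          exact Q.neg_mem (Q.mul_mem_right _ h0)
        exact (Ideal.IsPrime.mem_or_mem ‹_› this).resolve_left fun h => hC (hQJ h)
    have := (hcodim.trans (Ideal.height_mono this)).trans h1
    exact absurd this (by decide)
  · intro i
    rcases Fin.eq_self_or_eq_succAbove i₀ i with rfl | ⟨t, rfl⟩
    · simp
    · refine (Ideal.IsPrime.mem_or_mem (I := J) inferInstance (x := δ) ?_).resolve_left hC
      have h1 : ((q ᵥ* A) ᵥ* (C * (A.submatrix i₀.succAbove id * C).adjugate)) t ∈ J := by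
        rw [vecMul_eq_sum, Finset.sum_apply]
        exact J.sum_mem fun j _ => J.mul_mem_right _ (hqA j)
      rw [← hq t] at h1
      have := J.neg_mem (J.mul_mem_left (f i₀) h1)
      convert this using 1
      linear_combination (q i₀) * hf t

/-! ### Homogeneous polynomials -/

theorem aeval_mul_of_isHomogeneous {R T σ : Type*} [CommSemiring R] [CommSemiring T] [Algebra R T]
    {p : MvPolynomial σ R} {d : ℕ} (hp : p.IsHomogeneous d) (c : T) (x : σ → T) :
    aeval (fun i => c * x i) p = c ^ d * aeval x p := by
  rw [aeval_def, aeval_def, eval₂_eq, eval₂_eq, Finset.mul_sum]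
  refine Finset.sum_congr rfl fun m hm => ?_
  have : m.degree = d := by
    by_contra h
    exact (mem_support_iff.1 hm) (hp.coeff_eq_zero h)
  simp only [mul_pow, Finset.prod_mul_distrib, Finset.prod_pow_eq_pow_sum]
  rw [show ∑ i ∈ m.support, m i = d from this]
  ring

theorem homogeneousComponent_mul_of_isHomogeneous {R σ : Type*} [CommSemiring R]
    {p b : MvPolynomial σ R} {d : ℕ} (hp : p.IsHomogeneous d) (D : ℕ) :
    homogeneousComponent (d + D) (p * b) = p * homogeneousComponent D b := by
  conv_lhs => rw [← sum_homogeneousComponent b, Finset.mul_sum, map_sum]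
  have : ∀ j, homogeneousComponent (d + D) (p * homogeneousComponent j b) =
      if j = D then p * homogeneousComponent D b else 0 := by
    intro j
    rw [homogeneousComponent_of_mem (m := d + D) (n := d + j)
      (hp.mul (homogeneousComponent_isHomogeneous j b))]
    split_ifs with h1 h2 h2
    · subst h2; rfl
    · omega
    · omega
    · rfl
  simp only [this]
  rw [Finset.sum_ite_eq']
  split_ifs with h
  · rfl
  · rw [homogeneousComponent_eq_zero, mul_zero]
    simpa using h

theorem isHomogeneous_det {R σ ι : Type*} [CommRing R] [Fintype ι] [DecidableEq ι]
    (L : Matrix ι ι (MvPolynomial σ R)) (hL : ∀ i j, (L i j).IsHomogeneous 1) :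
    L.det.IsHomogeneous (Fintype.card ι) := by
  rw [Matrix.det_apply]
  refine IsHomogeneous.sum _ _ _ fun s _ => ?_
  have h : (∏ i, L (s i) i).IsHomogeneous (Fintype.card ι) := by
    simpa using IsHomogeneous.prod Finset.univ (fun i => L (s i) i) (fun _ => 1)
      fun i _ => hL _ _
  rcases Int.units_eq_one_or (Equiv.Perm.sign s) with h1 | h1 <;> rw [h1]
  · simpa using h
  · simpa using h.neg

/-! ### Syzygy row ideals and the rational left inverse -/

variable {k : Type*} [Field k]

/-- The ideal generated by all entries of the generalized row at `q` of the full syzygy matrix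
of `f`. -/
def syzygyRowIdeal {σ : Type*} {r : ℕ} (f : Fin (r + 1) → MvPolynomial σ k)
    (q : Fin (r + 1) → k) : Ideal (MvPolynomial σ k) where
  carrier := {a | ∃ B : Fin (r + 1) → MvPolynomial σ k,
    ∑ i, f i * B i = 0 ∧ ∑ i, C (q i) * B i = a}
  add_mem' := by
    rintro _ _ ⟨B, hB, rfl⟩ ⟨B', hB', rfl⟩
    exact ⟨B + B', by simp [mul_add, Finset.sum_add_distrib, hB, hB'],
      by simp [mul_add, Finset.sum_add_distrib]⟩
  zero_mem' := ⟨0, by simp, by simp⟩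
  smul_mem' := by
    rintro c _ ⟨B, hB, rfl⟩
    refine ⟨c • B, ?_, ?_⟩
    · simp [mul_left_comm _ c, ← Finset.mul_sum, hB]
    · simp [mul_left_comm _ c, ← Finset.mul_sum]

theorem aeval_mem_syzygyRowIdeal {σ τ : Type*} {r : ℕ} {f : Fin (r + 1) → MvPolynomial σ k}
    {q : Fin (r + 1) → k} {a : MvPolynomial σ k} (ha : a ∈ syzygyRowIdeal f q)
    (x : σ → MvPolynomial τ k) :
    aeval x a ∈ syzygyRowIdeal (fun i => aeval x (f i)) q := by
  obtain ⟨B, hB, rfl⟩ := ha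
  refine ⟨fun i => aeval x (B i), ?_, ?_⟩
  · simpa using congrArg (aeval x) hB
  · simp [algebraMap_eq]

theorem exists_isHomogeneous_of_mem_syzygyRowIdeal {σ : Type*} {r d D : ℕ}
    {f : Fin (r + 1) → MvPolynomial σ k} (hf : ∀ i, (f i).IsHomogeneous d)
    {q : Fin (r + 1) → k} {a : MvPolynomial σ k} (haD : a.IsHomogeneous D)
    (ha : a ∈ syzygyRowIdeal f q) :
    ∃ B : Fin (r + 1) → MvPolynomial σ k, (∀ i, (B i).IsHomogeneous D) ∧
      ∑ i, f i * B i = 0 ∧ ∑ i, C (q i) * B i = a := by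
  obtain ⟨B, hB, hBa⟩ := ha
  refine ⟨fun i => homogeneousComponent D (B i),
    fun i => homogeneousComponent_isHomogeneous _ _, ?_, ?_⟩
  · simpa [homogeneousComponent_mul_of_isHomogeneous (hf _)] using
      congrArg (homogeneousComponent (d + D)) hB
  · simpa [homogeneousComponent_C_mul, homogeneousComponent_eq_self haD] using
      congrArg (homogeneousComponent D) hBa

/-- The variables of `ν` are traded one at a time for multiples of `X a`. Total degree `N + 1`
leaves a cofactor of degree `N` at each trade, as `hI` demands. -/
theorem exists_monomial_sub_mem_syzygyRowIdeal {n : ℕ}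
    (I : Ideal (MvPolynomial (Fin (n + 1)) k)) (c : Fin (n + 1) → k) (a : Fin (n + 1)) (N : ℕ)
    (hI : ∀ i, ∀ b ∈ idealOfVars (Fin (n + 1)) k ^ N, (X i - C (c i) * X a) * b ∈ I)
    (s : ℕ) : ∀ (t : ℕ) (ν : Fin (n + 1) →₀ ℕ), ν.degree = s → s + t = N + 1 →
      ∃ e : k, X a ^ t * monomial ν 1 - C e * X a ^ (N + 1) ∈ I := by
  induction s with
  | zero =>
    intro t ν hν ht
    rw [Finsupp.degree_eq_zero_iff] at hν
    subst hν
    refine ⟨1, ?_⟩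
    rw [show t = N + 1 by omega]
    simp
  | succ s ih =>
    intro t ν hν ht
    obtain ⟨i, hi⟩ : ∃ i, ν i ≠ 0 := by
      by_contra! h
      rw [show ν = 0 from Finsupp.ext h] at hν
      simp at hν
    obtain ⟨ν', rfl⟩ : ∃ ν', ν = ν' + Finsupp.single i 1 :=
      ⟨ν - Finsupp.single i 1, (tsub_add_cancel_of_le (by
        rw [Finsupp.single_le_iff]; omega)).symm⟩
    have hν' : ν'.degree = s := by simpa using hν
    obtain ⟨e, he⟩ := ih (t + 1) ν' hν' (by omega)
    refine ⟨c i * e, ?_⟩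
    have hb : (X a ^ t * monomial ν' 1 : MvPolynomial (Fin (n + 1)) k) ∈
        idealOfVars (Fin (n + 1)) k ^ N := by
      rw [X_pow_eq_monomial, monomial_mul, monomial_mem_pow_idealOfVars_iff _ _ (by simp)]
      simp; omega
    have := I.add_mem (hI i _ hb) (I.mul_mem_left (C (c i)) he)
    convert this using 1
    rw [← mul_one (1 : k), ← monomial_mul, mul_one, map_mul]
    simp only [X]
    ring

open Matrix in
/-- If, near the point `[c]` of `ℙⁿ`, the generalized row at `q` of the syzygy matrix of `f` defines
a reduced point, and `q` lies in the closure of the image of `f`, then `f` has a rational left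
inverse. -/
theorem exists_leftInverse {n r d : ℕ} (f : Fin (r + 1) → MvPolynomial (Fin (n + 1)) k)
    (hf : ∀ i, (f i).IsHomogeneous d) (q : Fin (r + 1) → k) (c : Fin (n + 1) → k)
    (a : Fin (n + 1)) (N : ℕ)
    (hrow : ∀ i, ∀ b ∈ idealOfVars (Fin (n + 1)) k ^ N,
      (X i - C (c i) * X a) * b ∈ syzygyRowIdeal f q)
    (hq : ∀ (e : ℕ) (h : MvPolynomial (Fin (r + 1)) k), h.IsHomogeneous e →
      aeval f h = 0 → eval q h = 0) :
    ∃ (e : ℕ) (g : Fin (n + 1) → MvPolynomial (Fin (r + 1)) k),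
      (∀ i, (g i).IsHomogeneous e) ∧ (∃ i, aeval f (g i) ≠ 0) ∧
      (∀ i j, aeval f (g i) * X j = aeval f (g j) * X i) := by
  classical
  set D := N + 1 with hD
  let aD : Fin (n + 1) →₀ ℕ := Finsupp.single a D
  let T' : Finset (Fin (n + 1) →₀ ℕ) := Finset.finsuppAntidiag Finset.univ D
  have hT' : ∀ ν, ν ∈ T' ↔ ν.degree = D := fun ν => by
    simp [T', Finset.mem_finsuppAntidiag, Finsupp.degree_eq_sum]
  let T := T'.erase aD
  have haD : aD ∈ T' := by simp [hT', aD]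
  have hexp : ∀ p : MvPolynomial (Fin (n + 1)) k, p.IsHomogeneous D →
      p = C (coeff aD p) * X a ^ D + ∑ ν : T, C (coeff ν p) * monomial (ν : _ →₀ ℕ) 1 := by
    intro p hp
    have h1 : p = ∑ ν ∈ T', monomial ν (coeff ν p) := by
      conv_lhs => rw [p.as_sum]
      refine Finset.sum_subset (fun ν hν => ?_) (fun ν _ hν => by simp_all)
      rw [hT']
      by_contra h
      exact (mem_support_iff.1 hν) (hp.coeff_eq_zero h)
    rw [← Finset.add_sum_erase _ _ haD, ← Finset.sum_coe_sort] at h1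
    conv_lhs => rw [h1]
    simp [C_mul_monomial, X_pow_eq_monomial, aD, T]
  have hB : ∀ μ : T, ∃ e : k, ∃ B : Fin (r + 1) → MvPolynomial (Fin (n + 1)) k,
      (∀ i, (B i).IsHomogeneous D) ∧ ∑ i, f i * B i = 0 ∧
      ∑ i, C (q i) * B i = monomial (μ : _ →₀ ℕ) 1 - C e * X a ^ D := by
    intro μ
    have hμ : (μ : _ →₀ ℕ).degree = D := (hT' _).1 (Finset.mem_of_mem_erase μ.2)
    obtain ⟨e, he⟩ := exists_monomial_sub_mem_syzygyRowIdeal _ c a N hrow D 0 μ hμ rfl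
    rw [pow_zero, one_mul] at he
    exact ⟨e, exists_isHomogeneous_of_mem_syzygyRowIdeal hf
      ((isHomogeneous_monomial _ hμ).sub (isHomogeneous_C_mul_X_pow _ _ _)) he⟩
  choose e B hBD hBf hBq using hB
  -- The syzygies as linear equations in the monomials of degree `D`; `X a ^ D` is kept out of the
  -- unknowns and supplies the right side `L₀`.
  let L : Matrix T T (MvPolynomial (Fin (r + 1)) k) :=
    Matrix.of fun μ ν => ∑ i, C (coeff (ν : _ →₀ ℕ) (B μ i)) * X i
  let L₀ : T → MvPolynomial (Fin (r + 1)) k := fun μ => -∑ i, C (coeff aD (B μ i)) * X i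
  have hL : ∀ μ ν, (L μ ν).IsHomogeneous 1 := fun μ ν =>
    IsHomogeneous.sum Finset.univ (fun i => C (coeff (ν : _ →₀ ℕ) (B μ i)) * X i) _
      fun i _ => isHomogeneous_C_mul_X _ _
  have hL₀ : ∀ μ, (L₀ μ).IsHomogeneous 1 := fun μ =>
    (IsHomogeneous.sum _ _ _ fun i _ => isHomogeneous_C_mul_X _ _).neg
  have hLq : (L.map (eval q)) = 1 := by
    ext μ ν
    have h1 := congrArg (coeff (ν : _ →₀ ℕ)) (hBq μ)
    have h2 : (aD = ν) = False := eq_false fun h => Finset.ne_of_mem_erase ν.2 h.symm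
    simp only [X_pow_eq_monomial, coeff_sum, coeff_C_mul, coeff_sub, coeff_monomial,
      show Finsupp.single a D = aD from rfl, h2, if_false, mul_zero, sub_zero] at h1
    simp only [L, Matrix.map_apply, Matrix.of_apply, map_sum, map_mul, eval_C, eval_X,
      Matrix.one_apply, Subtype.ext_iff]
    rw [← h1]
    exact Finset.sum_congr rfl fun i _ => mul_comm _ _
  have hLf : L.map (aeval f) *ᵥ (fun ν : T => monomial (ν : _ →₀ ℕ) (1 : k)) =
      (X a ^ D : MvPolynomial (Fin (n + 1)) k) • (fun μ => aeval f (L₀ μ)) := by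
    ext1 μ
    have h1 : ∑ i, f i * (C (coeff aD (B μ i)) * X a ^ D +
        ∑ ν : T, C (coeff ν (B μ i)) * monomial (ν : _ →₀ ℕ) 1) = 0 := by
      rw [← hBf μ]
      exact Finset.sum_congr rfl fun i _ => by rw [← hexp _ (hBD μ i)]
    simp only [mul_add, Finset.sum_add_distrib, Finset.mul_sum] at h1
    rw [Finset.sum_comm (s := Finset.univ (α := Fin (r + 1)))] at h1
    simp only [Matrix.mulVec, dotProduct, L, L₀, Matrix.map_apply, Matrix.of_apply, map_sum,
      map_mul, map_neg, aeval_X, algHom_C, algebraMap_eq, Finset.sum_mul, Pi.smul_apply,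
      smul_eq_mul, mul_neg, Finset.mul_sum]
    rw [eq_neg_iff_add_eq_zero]
    refine Eq.trans ?_ ((add_comm _ _).trans h1)
    refine congrArg₂ HAdd.hAdd ?_ ?_
    · exact Finset.sum_congr rfl fun ν _ => Finset.sum_congr rfl fun i _ => by ring
    · exact Finset.sum_congr rfl fun i _ => by ring
  have hcr : ∀ μ : T, aeval f L.det * monomial (μ : _ →₀ ℕ) 1 =
      X a ^ D * aeval f (L.cramer L₀ μ) := by
    intro μ
    have h1 := congrFun (congrArg (fun x => (L.map (aeval f)).adjugate *ᵥ x) hLf) μ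
    simp only [mulVec_mulVec, adjugate_mul, mulVec_smul, smul_mulVec, one_mulVec, Pi.smul_apply,
      smul_eq_mul] at h1
    have h2 := (aeval f).map_adjugate L
    simp only [AlgHom.mapMatrix_apply] at h2
    rw [AlgHom.map_det, AlgHom.mapMatrix_apply, h1, cramer_eq_adjugate_mulVec, ← h2]
    simp [mulVec, dotProduct]
  -- A form vanishing on the image vanishes at `q`, but `det L` takes the value 1 there.
  have hdet : aeval f L.det ≠ 0 := by
    intro h
    have h1 := hq _ _ (isHomogeneous_det L hL) h
    rw [RingHom.map_det, RingHom.mapMatrix_apply, hLq] at h1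
    simp at h1
  -- The unknown X_a^N X_i, divided by X_a^D, is X_i / X_a. For `i = a` it is the excluded monomial,
  -- so that coordinate of the inverse is `det L`.
  let μ : Fin (n + 1) → Fin (n + 1) →₀ ℕ := fun i => Finsupp.single a N + Finsupp.single i 1
  have hμ : ∀ i, i ≠ a → μ i ∈ T := fun i hi => by
    refine Finset.mem_erase.2 ⟨fun h => ?_, (hT' _).2 (by simp [μ, hD])⟩
    have := DFunLike.congr_fun h i
    simp [μ, aD, hi.symm] at this
  refine ⟨Fintype.card T, fun i => if hi : i = a then L.det else L.cramer L₀ ⟨μ i, hμ i hi⟩,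
    fun i => ?_, ⟨a, by simpa using hdet⟩, ?_⟩
  · dsimp only
    split_ifs with hi
    · exact isHomogeneous_det L hL
    · rw [cramer_apply]
      refine isHomogeneous_det _ fun x y => ?_
      rw [updateCol_apply]
      split_ifs
      exacts [hL₀ _, hL _ _]
  · have hX : (X a : MvPolynomial (Fin (n + 1)) k) ≠ 0 := X_ne_zero a
    have key : ∀ i, X a * aeval f (if hi : i = a then L.det else L.cramer L₀ ⟨μ i, hμ i hi⟩) =
        aeval f L.det * X i := by
      intro i
      split_ifs with hi
      · rw [hi, mul_comm]
      · refine mul_left_cancel₀ (pow_ne_zero N hX) ?_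
        rw [← mul_assoc, ← pow_succ, ← hcr]
        simp only [μ]
        rw [show monomial (Finsupp.single a N + Finsupp.single i 1) (1 : k) =
          monomial (Finsupp.single a N) 1 * monomial (Finsupp.single i 1) 1 by simp [monomial_mul],
          X_pow_eq_monomial, X]
        ring
    intro i j
    refine mul_left_cancel₀ hX ?_
    rw [← mul_assoc, ← mul_assoc, key, key]
    ring

/-! ### From a left inverse to birationality -/

/-- The tuple g(f) is proportional to X with ratio g_j(f) / X_j, and a form of degree `d` scales by
the `d`-th power. -/
theorem aeval_aeval_mul_X_pow {n r d : ℕ} {f : Fin (r + 1) → MvPolynomial (Fin (n + 1)) k}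
    (hf : ∀ i, (f i).IsHomogeneous d) {g : Fin (n + 1) → MvPolynomial (Fin (r + 1)) k}
    (hg : ∀ i j, aeval f (g i) * X j = aeval f (g j) * X i) (i : Fin (r + 1)) (j : Fin (n + 1)) :
    aeval f (aeval g (f i)) * X j ^ d = aeval f (g j) ^ d * f i := by
  have h1 : aeval f (aeval g (f i)) = aeval (fun l => aeval f (g l)) (f i) := by
    rw [← comp_aeval_apply]
  rw [h1, mul_comm, ← aeval_mul_of_isHomogeneous (hf i)]
  conv_rhs => rw [← aeval_X_left_apply (f i), ← aeval_mul_of_isHomogeneous (hf i)]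
  congr 2
  ext1 l
  rw [mul_comm, hg]

theorem isBirationalOntoImage_of_leftInverse {n r d e : ℕ}
    {f : Fin (r + 1) → MvPolynomial (Fin (n + 1)) k} (hf : ∀ i, (f i).IsHomogeneous d)
    (hf0 : ∃ i, f i ≠ 0) {g : Fin (n + 1) → MvPolynomial (Fin (r + 1)) k}
    (hge : ∀ i, (g i).IsHomogeneous e) (hg0 : ∃ i, aeval f (g i) ≠ 0)
    (hg : ∀ i j, aeval f (g i) * X j = aeval f (g j) * X i) : IsBirationalOntoImage f := by
  have key := aeval_aeval_mul_X_pow hf hg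
  obtain ⟨a, ha⟩ := hg0
  refine ⟨e, g, hge, ⟨a, ha⟩, hg, ?_, fun i j => ?_⟩
  · obtain ⟨i, hi⟩ := hf0
    refine ⟨i, fun h => ?_⟩
    have := key i a
    rw [h, zero_mul] at this
    exact mul_ne_zero (pow_ne_zero _ ha) hi this.symm
  · refine mul_right_cancel₀ (pow_ne_zero d (X_ne_zero a)) ?_
    simp only [map_sub, map_mul, aeval_X, zero_mul]
    linear_combination f j * key i a - f i * key j a

/-- Each `X j` is a root of u T^d − g_j(f)^d f_i with u = f_i(g(f)) ≠ 0, so the polynomial ring is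
algebraic over k[f]. Its transcendence degree `r + 1` then leaves no relation among the `r + 1`
forms. -/
theorem algebraicIndependent_of_leftInverse {r d : ℕ} (hd : d ≠ 0)
    {f : Fin (r + 1) → MvPolynomial (Fin (r + 1)) k} (hf : ∀ i, (f i).IsHomogeneous d)
    (hf0 : ∃ i, f i ≠ 0) {g : Fin (r + 1) → MvPolynomial (Fin (r + 1)) k}
    (hg0 : ∃ i, aeval f (g i) ≠ 0)
    (hg : ∀ i j, aeval f (g i) * X j = aeval f (g j) * X i) : AlgebraicIndependent k f := by
  have key := aeval_aeval_mul_X_pow hf hg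
  obtain ⟨a, ha⟩ := hg0
  obtain ⟨i, hi⟩ := hf0
  let R := Algebra.adjoin k (Set.range f)
  have hmem : ∀ p : MvPolynomial (Fin (r + 1)) k, aeval f p ∈ R := fun p => by
    simp only [R, Algebra.adjoin_range_eq_range_aeval]
    exact ⟨p, rfl⟩
  have hne : aeval f (aeval g (f i)) ≠ 0 := by
    intro h
    have := key i a
    rw [h, zero_mul] at this
    exact mul_ne_zero (pow_ne_zero _ ha) hi this.symm
  let u : R := ⟨_, hmem (aeval g (f i))⟩
  let fi : R := ⟨f i, Algebra.subset_adjoin ⟨i, rfl⟩⟩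
  have hX : ∀ j, IsAlgebraic R (X j : MvPolynomial (Fin (r + 1)) k) := by
    intro j
    let w : R := ⟨_, hmem (g j)⟩
    refine ⟨Polynomial.C u * Polynomial.X ^ d - Polynomial.C (w ^ d * fi), fun h => ?_, ?_⟩
    · have := congrArg (fun p => Polynomial.coeff p d) h
      simp only [Polynomial.coeff_sub, Polynomial.coeff_C_mul, Polynomial.coeff_X_pow, if_true,
        mul_one, Polynomial.coeff_C, hd, if_false, sub_zero, Polynomial.coeff_zero] at this
      exact hne (congrArg Subtype.val this)
    · simp only [map_sub, map_mul, map_pow, Polynomial.aeval_C, Polynomial.aeval_X]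
      exact sub_eq_zero.2 (key i j)
  have halg : Algebra.IsAlgebraic R (MvPolynomial (Fin (r + 1)) k) := by
    refine ⟨fun p => ?_⟩
    induction p using MvPolynomial.induction_on with
    | C c => exact isAlgebraic_algebraMap (R := R) (algebraMap k R c)
    | add p q hp hq => exact hp.add hq
    | mul_X p j hp => exact hp.mul (hX j)
  refine (Algebra.IsAlgebraic.isTranscendenceBasis_of_lift_le_trdeg_of_finite k f ?_).1
  rw [MvPolynomial.trdeg_of_isDomain]
  simp

theorem isCremona_of_isBirationalOntoImage {r : ℕ}
    {f : Fin (r + 1) → MvPolynomial (Fin (r + 1)) k} (hf : AlgebraicIndependent k f)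
    (h : IsBirationalOntoImage f) : IsCremona f := by
  obtain ⟨e, g, hge, hg0, hg, ⟨i, hi⟩, h5⟩ := h
  refine ⟨e, g, hge, hg0, hg, ⟨i, fun h => hi (by rw [h, map_zero])⟩, fun i j => ?_⟩
  exact sub_eq_zero.1 (hf.eq_zero_of_aeval_eq_zero _ (h5 i j))

/-! ### Saturation and ideals of linear subspaces -/

/-- The saturation is reached at a finite stage, uniformly on finitely many elements. -/
theorem exists_forall_mul_mem_of_mem_saturation {n : ℕ} {ι : Type*} [Fintype ι]
    (J : Ideal (MvPolynomial (Fin (n + 1)) k)) (l : ι → MvPolynomial (Fin (n + 1)) k)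
    (hl : ∀ i, l i ∈ saturation J) :
    ∃ N : ℕ, ∀ i, ∀ b ∈ idealOfVars (Fin (n + 1)) k ^ N, l i * b ∈ J := by
  choose N hN using fun i => mem_saturation.1 (hl i)
  exact ⟨Finset.univ.sup N, fun i b hb =>
    hN i b (Ideal.pow_le_pow_right (Finset.le_sup (Finset.mem_univ i)) hb)⟩

theorem le_saturation {n : ℕ} (J : Ideal (MvPolynomial (Fin (n + 1)) k)) : J ≤ saturation J :=
  fun _ ha => mem_saturation.2 ⟨0, fun _ _ => J.mul_mem_right _ ha⟩

theorem eval_linearSubst {n s : ℕ} (M : Matrix (Fin (n + 1)) (Fin (s + 1)) k)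
    (w : Fin (s + 1) → k) (p : MvPolynomial (Fin (n + 1)) k) :
    eval w (aeval (fun a => ∑ b, C (M a b) * X b) p) = eval (M.mulVec w) p := by
  rw [← coe_aeval_eq_eval, ← coe_aeval_eq_eval]
  simp only [RingHom.coe_coe]
  rw [comp_aeval_apply]
  simp only [map_sum, map_mul, algHom_C, Algebra.algebraMap_self, RingHom.id_apply, aeval_X]
  rfl

theorem exists_linear_projection {n : ℕ} (V : Submodule k (Fin (n + 1) → k)) :
    ∃ E : Matrix (Fin (n + 1)) (Fin (n + 1)) k, (∀ x, E.mulVec x ∈ V) ∧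
      ∀ v ∈ V, E.mulVec v = v := by
  obtain ⟨p, hp⟩ := V.subtype.exists_leftInverse_of_injective V.ker_subtype
  refine ⟨LinearMap.toMatrix' (V.subtype ∘ₗ p), fun x => ?_, fun v hv => ?_⟩
  · rw [← Matrix.toLin'_apply, Matrix.toLin'_toMatrix']
    exact (p x).2
  · rw [← Matrix.toLin'_apply, Matrix.toLin'_toMatrix']
    exact congrArg Subtype.val (LinearMap.congr_fun hp ⟨v, hv⟩)

/-- Modulo the linear ideal, x ≡ E x, since the rows of 1 − E vanish on `V`. The kernel description
gives primality and, over an infinite field, detection by points of `V`. -/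
theorem linearIdeal_eq_ker {n : ℕ} {V : Submodule k (Fin (n + 1) → k)}
    {E : Matrix (Fin (n + 1)) (Fin (n + 1)) k} (h1 : ∀ x, E.mulVec x ∈ V)
    (h2 : ∀ v ∈ V, E.mulVec v = v) :
    linearIdeal V = RingHom.ker (aeval fun a => ∑ b, C (E a b) * X b :
      MvPolynomial (Fin (n + 1)) k →ₐ[k] MvPolynomial (Fin (n + 1)) k) := by
  apply le_antisymm
  · rw [linearIdeal, Ideal.span_le]
    rintro _ ⟨a, ha, rfl⟩
    have : ∀ b, ∑ i, a i * E i b = 0 := fun b => by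
      simpa using ha _ (h1 (Pi.single b 1))
    simp only [SetLike.mem_coe, RingHom.mem_ker, map_sum, map_mul, algHom_C, aeval_X,
      algebraMap_eq, Finset.mul_sum]
    rw [Finset.sum_comm]
    refine Finset.sum_eq_zero fun b _ => ?_
    simp_rw [← mul_assoc, ← C_mul, ← Finset.sum_mul, ← map_sum, this]
    simp
  · intro p hp
    have hX : ∀ a, Ideal.Quotient.mk (linearIdeal V) (X a) =
        Ideal.Quotient.mk (linearIdeal V) (∑ b, C (E a b) * X b) := by
      intro a
      rw [Ideal.Quotient.eq]
      refine Ideal.subset_span ⟨Pi.single a 1 - E a, fun v hv => ?_, ?_⟩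
      · have := congrFun (h2 v hv) a
        simp only [Matrix.mulVec, dotProduct] at this
        simp [sub_mul, Finset.sum_sub_distrib, Pi.single_apply, this]
      · simp [sub_mul, Finset.sum_sub_distrib, Pi.single_apply, apply_ite C]
    rw [← Ideal.Quotient.eq_zero_iff_mem, ← Ideal.Quotient.mkₐ_eq_mk k, ← aeval_X_left_apply p,
      comp_aeval_apply, Ideal.Quotient.mkₐ_eq_mk k]
    simp only [hX]
    rw [RingHom.mem_ker] at hp
    have := congrArg (Ideal.Quotient.mkₐ k (linearIdeal V)) hp
    rw [comp_aeval_apply, map_zero] at this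
    exact this

theorem linearIdeal_isPrime {n : ℕ} (V : Submodule k (Fin (n + 1) → k)) :
    (linearIdeal V).IsPrime := by
  obtain ⟨E, h1, h2⟩ := exists_linear_projection V
  rw [linearIdeal_eq_ker h1 h2]
  exact RingHom.ker_isPrime _

theorem eval_eq_zero_of_mem_linearIdeal {n : ℕ} {V : Submodule k (Fin (n + 1) → k)}
    {p : MvPolynomial (Fin (n + 1)) k} (hp : p ∈ linearIdeal V) {v : Fin (n + 1) → k}
    (hv : v ∈ V) : eval v p = 0 := by
  have : linearIdeal V ≤ RingHom.ker (eval v) := by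
    rw [linearIdeal, Ideal.span_le]
    rintro _ ⟨a, ha, rfl⟩
    simpa using ha v hv
  exact this hp

theorem exists_eval_ne_zero_of_notMem_linearIdeal [Infinite k] {n : ℕ}
    {V : Submodule k (Fin (n + 1) → k)} {p : MvPolynomial (Fin (n + 1)) k}
    (hp : p ∉ linearIdeal V) : ∃ v ∈ V, eval v p ≠ 0 := by
  obtain ⟨E, h1, h2⟩ := exists_linear_projection V
  by_contra! h
  refine hp ?_
  rw [linearIdeal_eq_ker h1 h2, RingHom.mem_ker]
  refine MvPolynomial.funext fun x => ?_
  rw [map_zero, eval_linearSubst, h _ (h1 x)]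

/-- If `P` omits a variable, its powers can be cancelled; otherwise `P` contains every linear form.
-/
theorem linearIdeal_le_of_saturation_eq {n : ℕ} {V : Submodule k (Fin (n + 1) → k)}
    {I P : Ideal (MvPolynomial (Fin (n + 1)) k)} [P.IsPrime] (hI : I ≤ P)
    (hV : saturation I = linearIdeal V) : linearIdeal V ≤ P := by
  by_cases h : ∃ i, X i ∉ P
  · obtain ⟨i, hi⟩ := h
    rw [← hV]
    intro p hp
    obtain ⟨N, hN⟩ := mem_saturation.1 hp
    have := hI (hN (X i ^ N) (Ideal.pow_mem_pow (Ideal.subset_span (Set.mem_range_self i)) N))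
    exact (Ideal.IsPrime.mem_or_mem ‹_› this).resolve_right
      fun h => hi (Ideal.IsPrime.mem_of_pow_mem ‹_› _ h)
  · push Not at h
    rw [linearIdeal, Ideal.span_le]
    rintro _ ⟨a, -, rfl⟩
    exact P.sum_mem fun i _ => P.mul_mem_left _ (h i)

theorem generalizedRowIdeal_le_syzygyRowIdeal {n r m : ℕ}
    {f : Fin (r + 1) → MvPolynomial (Fin (n + 1)) k}
    {A : Matrix (Fin (r + 1)) (Fin m) (MvPolynomial (Fin (n + 1)) k)}
    (hsyz : ∀ j, ∑ i, f i * A i j = 0) (q : ℙ k (Fin (r + 1) → k)) :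
    generalizedRowIdeal A q ≤ syzygyRowIdeal f q.rep := by
  rw [generalizedRowIdeal, Ideal.span_le]
  rintro _ ⟨j, rfl⟩
  exact ⟨fun i => A i j, hsyz j, rfl⟩

/-- By homogeneity q_{i₀}^e h(x) = x_{i₀}^e h(q). -/
theorem eval_eq_zero_of_proportional {r e : ℕ} {T : Type*} [CommRing T] [IsDomain T] [Algebra k T]
    (x : Fin (r + 1) → T) (q : Fin (r + 1) → k) (i₀ : Fin (r + 1)) (hx : x i₀ ≠ 0)
    (hxq : ∀ i, x i * algebraMap k T (q i₀) = x i₀ * algebraMap k T (q i))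
    {h : MvPolynomial (Fin (r + 1)) k} (he : h.IsHomogeneous e) (h0 : aeval x h = 0) :
    eval q h = 0 := by
  have h1 := aeval_mul_of_isHomogeneous he (algebraMap k T (q i₀)) x
  have h2 := aeval_mul_of_isHomogeneous he (x i₀) (fun i => algebraMap k T (q i))
  rw [h0, mul_zero] at h1
  simp only [mul_comm (algebraMap k T (q i₀)), hxq] at h1
  rw [h1] at h2
  have h3 := (mul_eq_zero.1 h2.symm).resolve_left (pow_ne_zero _ hx)
  rw [show (fun i => algebraMap k T (q i)) = algebraMap k T ∘ q from rfl,
    aeval_algebraMap_apply, map_eq_zero_iff _ (algebraMap k T).injective] at h3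
  simpa [coe_aeval_eq_eval] using h3

/-! ### Restriction to linear subspaces -/

theorem linearSubst_linearSubst {n s t : ℕ} (M : Matrix (Fin (n + 1)) (Fin (s + 1)) k)
    (M' : Matrix (Fin (t + 1)) (Fin (n + 1)) k) (b : MvPolynomial (Fin (t + 1)) k) :
    aeval (fun a => ∑ b, C (M a b) * X b)
      (aeval (fun j => ∑ a, C (M' j a) * X a : _ → MvPolynomial (Fin (n + 1)) k) b) =
    aeval (fun j => ∑ b, C ((M' * M) j b) * X b : _ → MvPolynomial (Fin (s + 1)) k) b := by
  rw [comp_aeval_apply]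
  congr 2
  ext1 j
  simp only [map_sum, map_mul, algHom_C, aeval_X, algebraMap_eq, Matrix.mul_apply, Finset.mul_sum,
    Finset.sum_mul]
  rw [Finset.sum_comm]
  simp only [mul_assoc]

theorem linearSubst_mem_pow {n s N : ℕ} (M : Matrix (Fin (n + 1)) (Fin (s + 1)) k)
    {b : MvPolynomial (Fin (n + 1)) k} (hb : b ∈ idealOfVars (Fin (n + 1)) k ^ N) :
    aeval (fun a => ∑ b, C (M a b) * X b) b ∈ idealOfVars (Fin (s + 1)) k ^ N := by
  have h1 := Ideal.mem_map_of_mem (aeval (fun a => ∑ b, C (M a b) * X b) :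
    MvPolynomial (Fin (n + 1)) k →ₐ[k] MvPolynomial (Fin (s + 1)) k) hb
  rw [Ideal.map_pow] at h1
  refine Ideal.pow_right_mono ?_ N h1
  rw [Ideal.map_span, Ideal.span_le]
  rintro _ ⟨_, ⟨a, rfl⟩, rfl⟩
  simp only [SetLike.mem_coe, aeval_X]
  exact Ideal.sum_mem _ fun b _ => Ideal.mul_mem_left _ _ (Ideal.subset_span ⟨b, rfl⟩)

open Matrix in
/-- A linear subspace `V` of codimension `r` is cut out by the rows of index `≠ 0` of a matrix with
`r + 1` rows which has a right inverse whose first column is a given nonzero vector of `V`. -/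
theorem exists_matrix_of_finrank {n r : ℕ} (V : Submodule k (Fin (n + 1) → k))
    (hV : Module.finrank k V + r = n + 1) (v : Fin (n + 1) → k) (hv : v ∈ V) (hv0 : v ≠ 0) :
    ∃ (L : Matrix (Fin (r + 1)) (Fin (n + 1)) k) (M : Matrix (Fin (n + 1)) (Fin (r + 1)) k),
      (∀ x, x ∈ V ↔ ∀ s : Fin r, (L *ᵥ x) s.succ = 0) ∧ L * M = 1 ∧ ∀ i, M i 0 = v i := by
  obtain ⟨b, hb⟩ : ∃ b, v b ≠ 0 := by
    by_contra! h
    exact hv0 (funext h)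
  have hfr : Module.finrank k ((Fin (n + 1) → k) ⧸ V) = Module.finrank k (Fin r → k) := by
    have := V.finrank_quotient_add_finrank
    simp at this ⊢
    omega
  let φ : (Fin (n + 1) → k) →ₗ[k] (Fin r → k) :=
    (LinearEquiv.ofFinrankEq _ _ hfr).toLinearMap ∘ₗ V.mkQ
  have hφV : ∀ x, x ∈ V ↔ φ x = 0 := fun x => by simp [φ]
  have hφs : Function.Surjective φ :=
    (LinearEquiv.surjective _).comp V.mkQ_surjective
  -- Row 0 is a coordinate functional scaled to take the value 1 at `v`.
  let L : Matrix (Fin (r + 1)) (Fin (n + 1)) k :=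
    Matrix.of (Fin.cons (Pi.single b (v b)⁻¹) (LinearMap.toMatrix' φ))
  have hL0 : ∀ x, (L *ᵥ x) 0 = (v b)⁻¹ * x b := fun x => by
    change Pi.single b (v b)⁻¹ ⬝ᵥ x = _
    simp
  have hLs : ∀ x s, (L *ᵥ x) s.succ = φ x s := fun x s => by
    conv_rhs => rw [← Matrix.toLin'_toMatrix' φ, Matrix.toLin'_apply]
    rfl
  choose u hu using fun s : Fin r => hφs (Pi.single s 1)
  -- Subtracting a multiple of `v ∈ V` kills row 0 without changing `φ`.
  let M : Matrix (Fin (n + 1)) (Fin (r + 1)) k :=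
    (Matrix.of (Fin.cons v fun s => u s - ((v b)⁻¹ * u s b) • v))ᵀ
  refine ⟨L, M, fun x => ?_, ?_, fun i => by simp [M]⟩
  · rw [hφV, _root_.funext_iff]
    simp [hLs]
  · ext s t
    refine Fin.cases ?_ (fun t => ?_) t
    · have h1 : (L * M) s 0 = (L *ᵥ v) s := by simp [Matrix.mul_apply, mulVec, dotProduct, M]
      rw [h1]
      refine Fin.cases ?_ (fun s => ?_) s
      · simp [hL0, hb]
      · simp [hLs, (hφV v).1 hv]
    · have h1 : (L * M) s t.succ = (L *ᵥ (u t - ((v b)⁻¹ * u t b) • v)) s := by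
        simp [Matrix.mul_apply, mulVec, dotProduct, M]
      rw [h1]
      refine Fin.cases ?_ (fun s => ?_) s
      · rw [hL0, Matrix.one_apply_ne (Fin.succ_ne_zero t).symm]
        simp only [Pi.sub_apply, Pi.smul_apply, smul_eq_mul]
        field_simp
        simp
      · simp [hLs, (hφV v).1 hv, hu, Matrix.one_apply, Pi.single_apply]

theorem isHomogeneous_restrictTo {n r s d : ℕ} {f : Fin (r + 1) → MvPolynomial (Fin (n + 1)) k}
    (hf : ∀ i, (f i).IsHomogeneous d) (M : Matrix (Fin (n + 1)) (Fin (s + 1)) k)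
    (i : Fin (r + 1)) : (restrictTo f M i).IsHomogeneous d := by
  rw [← one_mul d]
  exact (hf i).aeval _ fun a => IsHomogeneous.sum _ _ _ fun b _ => isHomogeneous_C_mul_X _ _

theorem eval_restrictTo {n r s : ℕ} (f : Fin (r + 1) → MvPolynomial (Fin (n + 1)) k)
    (M : Matrix (Fin (n + 1)) (Fin (s + 1)) k) (w : Fin (s + 1) → k) (i : Fin (r + 1)) :
    eval w (restrictTo f M i) = eval (M.mulVec w) (f i) := eval_linearSubst M w (f i)

theorem eval_zero_of_isHomogeneous {σ : Type*} {d : ℕ} (hd : d ≠ 0) {p : MvPolynomial σ k}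
    (hp : p.IsHomogeneous d) : eval 0 p = 0 := by
  have := aeval_mul_of_isHomogeneous hp (0 : k) (0 : σ → k)
  simpa [hd, coe_aeval_eq_eval, Pi.zero_def] using this

open Matrix in
theorem isCremona_restrictTo {n r d : ℕ} (hd : d ≠ 0)
    {f : Fin (r + 1) → MvPolynomial (Fin (n + 1)) k} (hf : ∀ i, (f i).IsHomogeneous d)
    (q : Fin (r + 1) → k) (V : Submodule k (Fin (n + 1) → k)) (i₀ : Fin (r + 1))
    (hfq : ∀ i, f i * C (q i₀) - f i₀ * C (q i) ∈ linearIdeal V)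
    (L : Matrix (Fin (r + 1)) (Fin (n + 1)) k)
    (hL : ∀ x, x ∈ V ↔ ∀ s : Fin r, (L *ᵥ x) s.succ = 0) (N : ℕ)
    (hrow : ∀ s : Fin r, ∀ b ∈ idealOfVars (Fin (n + 1)) k ^ N,
      (∑ a, C (L s.succ a) * X a) * b ∈ syzygyRowIdeal f q)
    (M : Matrix (Fin (n + 1)) (Fin (r + 1)) k) (hdet : (L * M).det ≠ 0)
    (hM : eval (M *ᵥ fun b => (L * M).adjugate b 0) (f i₀) ≠ 0) :
    IsCremona (restrictTo f M) := by
  -- As (L M) w = det(L M) e_0, the point M w is where the section meets `V`. The adjugate keeps `w`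
  -- polynomial in `M`.
  set w : Fin (r + 1) → k := fun b => (L * M).adjugate b 0 with hw
  have hLMw : ∀ s : Fin r, ((L * M) *ᵥ w) s.succ = 0 := fun s => by
    have := congrFun (congrFun (mul_adjugate (L * M)) s.succ) 0
    simpa [Matrix.mul_apply, mulVec, dotProduct, hw] using this
  have hLMw0 : ((L * M) *ᵥ w) 0 = (L * M).det := by
    have := congrFun (congrFun (mul_adjugate (L * M)) 0) 0
    simpa [Matrix.mul_apply, mulVec, dotProduct, hw] using this
  have hMwV : M *ᵥ w ∈ V := (hL _).2 fun s => by rw [mulVec_mulVec, hLMw]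
  obtain ⟨a, ha⟩ : ∃ a, w a ≠ 0 := by
    by_contra! h
    rw [show w = 0 from funext h, mulVec_zero] at hM
    exact hM (eval_zero_of_isHomogeneous hd (hf i₀))
  have hunit : IsUnit (L * M).det := isUnit_iff_ne_zero.2 hdet
  have hfM := isHomogeneous_restrictTo hf M
  have hfM0 : ∃ i, restrictTo f M i ≠ 0 := ⟨i₀, fun h => hM (by
    rw [← eval_restrictTo, h, map_zero])⟩
  have hlin : ∀ i, ∃ β : Fin r → k, (X i - C (w i / w a) * X a : MvPolynomial (Fin (r + 1)) k) =
      ∑ s, C (β s) * aeval (fun a => ∑ b, C (M a b) * X b) (∑ a, C (L s.succ a) * X a :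
        MvPolynomial (Fin (n + 1)) k) := by
    intro i
    let α : Fin (r + 1) → k := Pi.single i 1 - Pi.single a (w i / w a)
    let β := α ᵥ* (L * M)⁻¹
    have hβ : β ᵥ* (L * M) = α := by simp [β, vecMul_vecMul, nonsing_inv_mul _ hunit]
    have hαw : α ⬝ᵥ w = 0 := by simp [α, sub_dotProduct, ha]
    -- Pairing with `w` leaves only β_0 det(L M), so only the rows that vanish on `V` contribute.
    have hβ0 : β 0 = 0 := by
      rw [← hβ, ← dotProduct_mulVec, dotProduct, Fin.sum_univ_succ] at hαw
      simpa [hLMw, hLMw0, hdet] using hαw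
    refine ⟨fun s => β s.succ, ?_⟩
    have hα : ∀ b, α b = ∑ s : Fin r, β s.succ * (L * M) s.succ b := fun b => by
      rw [← hβ, vecMul, dotProduct, Fin.sum_univ_succ, hβ0]
      simp
    have h1 : (X i - C (w i / w a) * X a : MvPolynomial (Fin (r + 1)) k) =
        ∑ b, C (α b) * X b := by
      simp [α, sub_mul, Finset.sum_sub_distrib, Pi.single_apply, apply_ite C]
    rw [h1]
    simp only [hα, map_sum, map_mul, algHom_C, aeval_X, algebraMap_eq, Matrix.mul_apply,
      Finset.mul_sum, Finset.sum_mul]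
    rw [Finset.sum_comm]
    refine Finset.sum_congr rfl fun s _ => ?_
    rw [Finset.sum_comm]
    simp only [mul_assoc]
  obtain ⟨e, g, hge, hg0, hg⟩ := exists_leftInverse (restrictTo f M) hfM q (fun i => w i / w a) a N
    (fun i b hb => by
      obtain ⟨β, hβ⟩ := hlin i
      -- Since (L M)⁻¹ L is a left inverse of M, `b` is the restriction of a polynomial on the
      -- ambient space lying in the same power of the irrelevant ideal.
      have hb1 := linearSubst_linearSubst M ((L * M)⁻¹ * L) b
      rw [Matrix.mul_assoc, nonsing_inv_mul _ hunit] at hb1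
      have hb2 : aeval (fun j => ∑ b, C ((1 : Matrix (Fin (r + 1)) (Fin (r + 1)) k) j b) * X b :
          _ → MvPolynomial (Fin (r + 1)) k) b = b := by
        conv_rhs => rw [← aeval_X_left_apply b]
        congr 2
        ext1 j
        simp [Matrix.one_apply, apply_ite C]
      rw [hβ, Finset.sum_mul]
      refine Ideal.sum_mem _ fun s _ => ?_
      rw [mul_assoc]
      refine Ideal.mul_mem_left _ _ ?_
      rw [← hb2, ← hb1, ← map_mul]
      exact aeval_mem_syzygyRowIdeal (hrow s _ (linearSubst_mem_pow _ hb)) _)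
    (fun e h he h0 => by
      refine eval_eq_zero_of_proportional (fun i => eval (M *ᵥ w) (f i)) q i₀ hM (fun i => ?_) he ?_
      · have := eval_eq_zero_of_mem_linearIdeal (hfq i) hMwV
        simpa [sub_eq_zero] using this
      · have := congrArg (aeval w : _ →ₐ[k] k) h0
        rw [comp_aeval_apply, map_zero] at this
        simpa [← eval_restrictTo, coe_aeval_eq_eval] using this)
  exact isCremona_of_isBirationalOntoImage
    (algebraicIndependent_of_leftInverse hd hfM hfM0 hg0 hg)
    (isBirationalOntoImage_of_leftInverse hfM hfM0 hge hg0 hg)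

-- Merges the two nonvanishing conditions of `isCremona_restrictTo` into one polynomial in the
-- entries of `M`.
open Matrix in
theorem exists_generic_polynomial {n r : ℕ} (p : MvPolynomial (Fin (n + 1)) k)
    (L : Matrix (Fin (r + 1)) (Fin (n + 1)) k) :
    ∃ G : MvPolynomial (Fin (n + 1) × Fin (r + 1)) k,
      ∀ M : Matrix (Fin (n + 1)) (Fin (r + 1)) k, eval (fun ab => M ab.1 ab.2) G =
        (L * M).det * eval (M *ᵥ fun b => (L * M).adjugate b 0) p := by
  let Mx : Matrix (Fin (n + 1)) (Fin (r + 1)) (MvPolynomial (Fin (n + 1) × Fin (r + 1)) k) :=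
    Matrix.of fun a b => X (a, b)
  let Lx : Matrix (Fin (r + 1)) (Fin (n + 1)) (MvPolynomial (Fin (n + 1) × Fin (r + 1)) k) :=
    Matrix.of fun a b => C (L a b)
  refine ⟨(Lx * Mx).det * aeval (Mx *ᵥ fun b => (Lx * Mx).adjugate b 0) p, fun M => ?_⟩
  set ε := aeval (R := k) (fun ab : Fin (n + 1) × Fin (r + 1) => M ab.1 ab.2) with hε
  have hMx : (Lx * Mx).map ε = L * M := by
    ext i j
    simp [Matrix.mul_apply, Mx, Lx, ε]
  have hadj : ∀ b, ε ((Lx * Mx).adjugate b 0) = (L * M).adjugate b 0 := fun b => by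
    rw [← hMx]
    exact congrFun (congrFun (ε.map_adjugate (Lx * Mx)) b) 0
  rw [← coe_aeval_eq_eval, ← coe_aeval_eq_eval]
  simp only [RingHom.coe_coe]
  rw [map_mul, ← hε, AlgHom.map_det, AlgHom.mapMatrix_apply, hMx, comp_aeval_apply]
  congr 3
  ext1 a
  simp only [mulVec, dotProduct, map_sum, map_mul, hadj]
  simp [Mx, ε]

theorem eq_zero_of_isHomogeneous_zero {n r : ℕ} {f : Fin (r + 1) → MvPolynomial (Fin (n + 1)) k}
    (hf : ∀ i, (f i).IsHomogeneous 0) (hlin : LinearIndependent k f) : r = 0 := by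
  by_contra hr
  have hle : Submodule.span k (Set.range f) ≤ Submodule.span k {1} := by
    rw [Submodule.span_le]
    rintro _ ⟨i, rfl⟩
    rw [SetLike.mem_coe, Submodule.mem_span_singleton]
    refine ⟨coeff 0 (f i), ?_⟩
    rw [smul_eq_C_mul, mul_one]
    exact (totalDegree_eq_zero_iff_eq_C.1 ((totalDegree_zero_iff_isHomogeneous _).2 (hf i))).symm
  have h1 := Submodule.finrank_mono hle
  rw [finrank_span_eq_card hlin, finrank_span_singleton one_ne_zero] at h1
  simp at h1
  omega

theorem isCremona_restrictTo_of_isHomogeneous_zero {n r : ℕ}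
    {f : Fin (r + 1) → MvPolynomial (Fin (n + 1)) k} (hf : ∀ i, (f i).IsHomogeneous 0)
    (hlin : LinearIndependent k f) (M : Matrix (Fin (n + 1)) (Fin (r + 1)) k) :
    IsCremona (restrictTo f M) := by
  obtain rfl := eq_zero_of_isHomogeneous_zero hf hlin
  have : Subsingleton (Fin (0 + 1)) := inferInstanceAs (Subsingleton (Fin 1))
  refine ⟨0, fun _ => 1, fun _ => isHomogeneous_one _ _, ⟨0, by simp⟩,
    fun i j => by rw [Subsingleton.elim i j], ⟨0, ?_⟩, fun i j => by rw [Subsingleton.elim i j]⟩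
  have h0 := hlin.ne_zero 0
  have h1 := totalDegree_eq_zero_iff_eq_C.1 ((totalDegree_zero_iff_isHomogeneous _).2 (hf 0))
  rw [h1] at h0
  rw [restrictTo, h1]
  simpa using h0

end RowIdeals

end

/-! ### The main theorem -/

open RowIdeals

theorem mainTheorem5 {k : Type*} [Field k] [Infinite k] (n r d m : ℕ)
    (f : Fin (r + 1) → MvPolynomial (Fin (n + 1)) k)
    (hf : ∀ i, (f i).IsHomogeneous d)
    (hlin : LinearIndependent k f)
    (hcodim : 2 ≤ (Ideal.span (Set.range f)).height)
    (A : Matrix (Fin (r + 1)) (Fin m) (MvPolynomial (Fin (n + 1)) k))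
    (hA : ∀ i j, ∃ e : ℕ, (A i j).IsHomogeneous e)
    (hsyz : ∀ j, ∑ i, f i * A i j = 0)
    (q : ℙ k (Fin (r + 1) → k))
    (P : Ideal (MvPolynomial (Fin (n + 1)) k)) [P.IsPrime]
    (hP : RowIdeals.generalizedRowIdeal A q ≤ P)
    (hrank : (A.map (algebraMap (MvPolynomial (Fin (n + 1)) k) P.ResidueField)).rank = r) :
    (RowIdeals.DefinesReducedRationalPoint (RowIdeals.generalizedRowIdeal A q) →
      RowIdeals.IsBirationalOntoImage f) ∧
    (RowIdeals.DefinesReducedLinearSpace (RowIdeals.generalizedRowIdeal A q) r →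
      RowIdeals.ForGeneralLinearSubspace n r
        (fun M => RowIdeals.IsCremona (RowIdeals.restrictTo f M))) := by
  obtain ⟨i₀, hi₀⟩ := Function.ne_iff.1 q.rep_nonzero
  have hmem : ∀ j, Matrix.vecMul (fun i => C (q.rep i)) A j ∈ generalizedRowIdeal A q := fun j =>
    Ideal.subset_span ⟨j, rfl⟩
  have hfA : Matrix.vecMul f A = 0 := funext hsyz
  have hCq : (C (q.rep i₀) : MvPolynomial (Fin (n + 1)) k) ∉ P := fun h =>
    ‹P.IsPrime›.ne_top (Ideal.eq_top_of_isUnit_mem _ h ((isUnit_iff_ne_zero.2 hi₀).map C))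
  obtain ⟨B, hB⟩ := exists_det_notMem_of_rank A P hrank (fun i => C (q.rep i)) i₀ hCq
    fun j => hP (hmem j)
  have hrow := generalizedRowIdeal_le_syzygyRowIdeal hsyz q
  constructor
  · rintro ⟨p, hp⟩
    obtain ⟨hf₀, hfq⟩ := notMem_and_mul_sub_mul_mem A f _ hcodim hfA P (fun j => hP (hmem j)) i₀ B hB
    obtain ⟨a, ha⟩ := Function.ne_iff.1 p.rep_nonzero
    obtain ⟨N, hN⟩ := exists_forall_mul_mem_of_mem_saturation (generalizedRowIdeal A q)
      (fun i => X i - C (p.rep i / p.rep a) * X a) (fun i => by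
        rw [hp]
        refine Ideal.subset_span ⟨Pi.single i 1 - Pi.single a (p.rep i / p.rep a), fun v hv => ?_, ?_⟩
        · rw [p.submodule_eq, Submodule.mem_span_singleton] at hv
          obtain ⟨t, rfl⟩ := hv
          have ha : p.rep a ≠ 0 := ha
          simp [sub_mul, Finset.sum_sub_distrib, Pi.single_apply]
          field_simp
          simp
        · simp [sub_mul, Finset.sum_sub_distrib, Pi.single_apply, apply_ite C])
    obtain ⟨e, g, hge, hg0, hg⟩ := exists_leftInverse f hf q.rep _ a N
      (fun i b hb => hrow (hN i b hb)) (fun e h he h0 => by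
        -- `P` need not be the ideal of a rational point, so proportionality is used in the domain
        -- `S ⧸ P`.
        refine eval_eq_zero_of_proportional (fun i => Ideal.Quotient.mk P (f i)) q.rep i₀
          (fun h => hf₀ (Ideal.Quotient.eq_zero_iff_mem.1 h)) (fun i => ?_) he ?_
        · have := Ideal.Quotient.eq_zero_iff_mem.2 (hfq i)
          rw [map_sub, map_mul, map_mul, sub_eq_zero] at this
          exact this
        · have := congrArg (Ideal.Quotient.mkₐ k P) h0
          rw [comp_aeval_apply, map_zero] at this
          exact this)
    exact isBirationalOntoImage_of_leftInverse hf ⟨0, hlin.ne_zero 0⟩ hge hg0 hg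
  · rintro ⟨V, -, hVr, hV⟩
    -- In degree 0 independence forces `r = 0`. For `d ≠ 0` forms vanish at the origin, so
    -- nonvanishing of `f i₀` certifies a nonzero vector.
    rcases eq_or_ne d 0 with rfl | hd
    · exact ⟨1, one_ne_zero, fun M _ _ => isCremona_restrictTo_of_isHomogeneous_zero hf hlin M⟩
    have hprime := linearIdeal_isPrime V
    have hJP : linearIdeal V ≤ P := linearIdeal_le_of_saturation_eq hP hV
    have hAJ : generalizedRowIdeal A q ≤ linearIdeal V := hV ▸ le_saturation _
    -- The prime of `V` replaces `P`: it also omits δ, and over an infinite field it yields a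
    -- rational point of `V` where `f i₀` is nonzero.
    obtain ⟨hf₀, hfq⟩ := notMem_and_mul_sub_mul_mem A f _ hcodim hfA (linearIdeal V)
      (fun j => hAJ (hmem j)) i₀ B fun h => hB (hJP h)
    obtain ⟨v, hv, hfv⟩ := exists_eval_ne_zero_of_notMem_linearIdeal hf₀
    have hv0 : v ≠ 0 := by
      rintro rfl
      exact hfv (eval_zero_of_isHomogeneous hd (hf i₀))
    obtain ⟨L, M₀, hL, hLM₀, hM₀⟩ := exists_matrix_of_finrank V hVr v hv hv0
    obtain ⟨N, hN⟩ := exists_forall_mul_mem_of_mem_saturation (generalizedRowIdeal A q)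
      (fun s : Fin r => ∑ a, C (L s.succ a) * X a) fun s => by
        rw [hV]
        exact Ideal.subset_span ⟨L s.succ, fun x hx => (hL x).1 hx s, rfl⟩
    obtain ⟨G, hG⟩ := exists_generic_polynomial (f i₀) L
    refine ⟨G, fun h => ?_, fun M _ hM => ?_⟩
    -- The section `M₀` meets `V` at `v`, where `f i₀` does not vanish, so `G` is nonzero.
    · have h1 := hG M₀
      have h2 : (M₀.mulVec fun b => (1 : Matrix (Fin (r + 1)) (Fin (r + 1)) k) b 0) = v := by
        ext i
        simp [Matrix.mulVec, dotProduct, Matrix.one_apply, hM₀]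
      rw [h, hLM₀, Matrix.adjugate_one, h2] at h1
      simp only [map_zero, Matrix.det_one, one_mul] at h1
      exact hfv h1.symm
    · rw [hG] at hM
      exact isCremona_restrictTo hd hf q.rep V i₀ hfq L hL N (fun s b hb => hrow (hN s b hb)) M
        (left_ne_zero_of_mul hM) (right_ne_zero_of_mul hM)
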